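/- Fix $d\ge 1$, $B>0$, $D>0$, $p\in[1,2)$ and $\varepsilon\in[0,1]$. A domain is a nonempty closed convex set $\mathcal X\subseteq\mathbb R^d$; let $\mathbb X_p(D)$ be the set of domains with $\|x-y\|_p\le D$ for all $x,y\in\mathcal X$. For $r\in[1,\infty]$ with Hölder conjugate $r'$ ($1/r+1/r'=1$), let $\mathcal O_{c,r}$ be the set of pairs $(f,O)$ of a convex function $f:\mathcal X\to\mathbb R$ and a stochastic oracle $O$ which, queried at $x\in\mathcal X$, returns (with fresh randomness) a random vector $\hat g(x)\in\mathbb R^d$ with $\mathbb E[\hat g(x)]\in\partial f(x)$ and $\|\hat g(x)\|_{r'}\le B$ almost surely. Let $\mathcal W_{\mathrm{priv},\varepsilon}$ be the set of $\varepsilon$-locally differentially private channels, that is, Markov kernels $W$ from $\mathbb R^d$ to $\mathbb R^d$ with $W(S\mid x)\le e^{\varepsilon}W(S\mid x')$ for all $x,x'\in\mathbb R^d$ and all Borel sets $S\subseteq\mathbb R^d$. At each step $t=1,\dots,T$ an algorithm $\pi$ queries a point $x_t\in\mathcal X$, the estimate $\hat g(x_t)$ is passed through a channel $W_t\in\mathcal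 W_{\mathrm{priv},\varepsilon}$ chosen by a strategy $S$, and only the channel output $Y_t$ is observed; $x_t$ and $W_t$ may both depend (measurably) on $Y_1,\dots,Y_{t-1}$ and on a random seed that is independent of the oracle and channel noise. After the $T$ queries $\pi$ outputs a point $\hat x\in\mathcal X$, a function of the seed and of $Y_1,\dots,Y_T$. The adaptive minmax optimization error is $$\mathcal E^*(\mathcal X,\mathcal O,T,\mathcal W)=\inf_{\pi}\inf_{S}\sup_{(f,O)\in\mathcal O}\mathbb E\Big[f(\hat x)-\min_{x\in\mathcal X}f(x)\Big].$$ Let $c_0=\frac{1}{2e(e-1)^2}$ and $c_1=\frac{1}{36(e-1)\sqrt{2e}}$. If $T\ge c_0\,d/\varepsilon^2$ (a condition that no $T$ satisfies when $\varepsilon=0$), then $$\sup_{\mathcal X\in\mathbb X_p(D)}\mathcal E^*(\mathcal X,\mathcal O_{c,1},T,\mathcal W_{\mathrm{priv},\varepsilon})\ \ge\ \frac{c_1DB}{\sqrt T}\sqrt{\frac{d}{\varepsilon^2}},$$ and the same lower bound holds with $\mathcal O_{c,p}$ (gradient estimates bounded in the norm $\ell_{p/(p-1)}$) in place of $\mathcal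 O_{c,1}$ (gradient estimates bounded in $\ell_\infty$). -/

import Mathlib

open MeasureTheory ProbabilityTheory
open scoped ENNReal

namespace PrivOpt

noncomputable section

/-- The space `ℝ^d`, with its product (Borel) measurable structure. -/
abbrev Vec (d : ℕ) : Type := Fin d → ℝ

/-- The `ℓ_p` norm on `ℝ^d`, `1 ≤ p ≤ ∞`. -/
def ellNorm {d : ℕ} (p : ℝ≥0∞) (x : Vec d) : ℝ := ‖(WithLp.toLp p x : PiLp p fun _ : Fin d => ℝ)‖

/-- The domains of `ℓ_p` diameter at most `D`. A domain of a convex minimization problem is a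
nonempty closed convex set. -/
def domains {d : ℕ} (p : ℝ≥0∞) (D : ℝ) : Set (Set (Vec d)) :=
  {X | X.Nonempty ∧ IsClosed X ∧ Convex ℝ X ∧ ∀ x ∈ X, ∀ y ∈ X, ellNorm p (x - y) ≤ D}

/-- The subgradients at `x` of a function on the domain `X`. -/
def subgradients {d : ℕ} (X : Set (Vec d)) (f : Vec d → ℝ) (x : Vec d) : Set (Vec d) :=
  {g | ∀ y ∈ X, f x + g ⬝ᵥ (y - x) ≤ f y}

/-- The pairs of a convex function `f` on `X` and a (randomized) first-order oracle `O`, where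
`O x` is the law of the gradient estimate at the query `x`: the estimates are unbiased, and their
`ℓ_q` norm is almost surely at most `B`, where `q` is the Hölder conjugate of `p`
(`q = ∞` for `p = 1`). -/
def convexOracles {d : ℕ} (X : Set (Vec d)) (p : ℝ≥0∞) (B : ℝ) :
    Set ((Vec d → ℝ) × Kernel (Vec d) (Vec d)) :=
  {fO | ConvexOn ℝ X fO.1 ∧ IsMarkovKernel fO.2 ∧ ∀ x ∈ X,
    (∫ g, g ∂(fO.2 x)) ∈ subgradients X fO.1 x ∧
    ∀ᵐ g ∂(fO.2 x), ellNorm (ENNReal.conjExponent p) g ^ 2 ≤ B ^ 2}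

/-- The `ε`-locally differentially private channels `ℝ^d → ℝ^d`. -/
def ldpChannels {d : ℕ} (ε : ℝ) : Set (Kernel (Vec d) (Vec d)) :=
  {W | IsMarkovKernel W ∧ ∀ x x' : Vec d, ∀ S : Set (Vec d), MeasurableSet S →
    W x S ≤ ENNReal.ofReal (Real.exp ε) * W x' S}

/-- What is known before the query number `t` (counted from `0`) is made: the value of the
algorithm's random seed, and the channel outputs `Y_0, …, Y_{t-1}`. -/
abbrev History (d t : ℕ) : Type := ℝ × (Fin t → Vec d)

/-- A first-order algorithm on the domain `X` that makes `T` queries: the query points (only those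
with `t < T` are ever made) and, after `T` queries, the output. Both may depend on all channel
outputs received so far, and on a random seed; a deterministic algorithm ignores the seed. -/
structure Algorithm {d : ℕ} (X : Set (Vec d)) (T : ℕ) where
  seed : Measure ℝ
  isProb : IsProbabilityMeasure seed
  query : (t : ℕ) → History d t → Vec d
  query_mem : ∀ t h, query t h ∈ X
  query_measurable : ∀ t, Measurable (query t)
  output : History d T → Vec d
  output_mem : ∀ h, output h ∈ X
  output_measurable : Measurable output

/-- An adaptive channel selection strategy: for each `t`, a map that (measurably) assigns to the
channel outputs received so far (and the seed) a channel of the family `𝒲`. -/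
structure Strategy {d : ℕ} (𝒲 : Set (Kernel (Vec d) (Vec d))) where
  channel : (t : ℕ) → Kernel (History d t × Vec d) (Vec d)
  isMarkov : ∀ t, IsMarkovKernel (channel t)
  channel_mem : ∀ t h, (channel t).sectR h ∈ 𝒲

variable {d T : ℕ} {X : Set (Vec d)} {𝒲 : Set (Kernel (Vec d) (Vec d))}

/-- The conditional law of the channel output `Y_t` given the history: the query point
`x_t` is computed, the oracle draws a gradient estimate from `O x_t`, and this is
passed through the selected channel. -/
def stepKernel (O : Kernel (Vec d) (Vec d)) (π : Algorithm X T) (S : Strategy 𝒲) (t : ℕ) :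
    Kernel (History d t) (Vec d) :=
  S.channel t ∘ₖ (Kernel.id ×ₖ O.comap (π.query t) (π.query_measurable t))

/-- The joint law of the channel outputs `(Y_0, …, Y_{t-1})`, as a function of the seed. -/
def transcript (O : Kernel (Vec d) (Vec d)) (π : Algorithm X T) (S : Strategy 𝒲) :
    (t : ℕ) → Kernel ℝ (Fin t → Vec d)
  | 0 => Kernel.const ℝ (Measure.dirac Fin.elim0)
  | t + 1 => (transcript O π S t ⊗ₖ stepKernel O π S t).map fun y => Fin.snoc y.1 y.2

/-- The optimization error `E[f(x̂) - min_X f]` of the output `x̂`. -/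
def optError (f : Vec d → ℝ) (O : Kernel (Vec d) (Vec d)) (π : Algorithm X T) (S : Strategy 𝒲) :
    ℝ≥0∞ :=
  ∫⁻ u, ∫⁻ y, ENNReal.ofReal (f (π.output (u, y)) - sInf (f '' X)) ∂(transcript O π S T u) ∂π.seed

/-- The adaptive minmax optimization error. -/
def minmaxError (X : Set (Vec d)) (𝒪 : Set ((Vec d → ℝ) × Kernel (Vec d) (Vec d))) (T : ℕ)
    (𝒲 : Set (Kernel (Vec d) (Vec d))) : ℝ≥0∞ :=
  ⨅ π : Algorithm X T, ⨅ S : Strategy 𝒲, ⨆ fO ∈ 𝒪, optError fO.1 fO.2 π S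

end

end PrivOpt

namespace PrivOpt

/-! The argument is Assouad's method with Hellinger affinities. For `v ∈ {±1}^d` the objective is
the linear function with gradient `βγv` on a cube `[-b, b]^d`, and the oracle answers `βs` with
independent signs `s_i` of mean `γ v_i`. The error at `x` is `βγ ∑ (b + v_i x_i)`, so a small error
means that most signs of `v` have been recovered. This is impossible while the transcript laws of
`v` and of its single-coordinate flips overlap.

The factor `√d` comes from treating the `d` flips jointly. Given the history, the density of a
private channel output, as a function `w` of `s`, varies by at most the factor `E = e^ε`. Flipping
`v_i` changes the mean of `w` by a multiple of its covariance with the `i`-th centered sign. These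
signs are orthogonal, so Bessel's inequality (`sum_sq_sum_centered_le`) bounds the sum of the `d`
squared changes by the variance of `w`, hence by `(E - 1)^2` times its squared mean. One query
therefore leaks about `γ^2 (e^ε - 1)^2` over all coordinates together, not in each of them.

`sum_sqrt_mul_add_le` converts this into a loss of affinity summed over `i` and `v`,
`AffinityBound.compProd` integrates it, and `affinityBound_transcript` iterates it; adaptivity is
harmless because the pointwise bound holds for every history. `AffinityBound.le_sum_loss` turns
affinity into error. With `γ` of order `√(d / (T ε^2))` the total leak is a small fraction of `d`,
so the error is of order `βγbd`, and Hölder conjugacy of the two norms gives `βbd = DB/2`. -/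

/-! ### Biased product measures on the sign cube -/

/-- The sign `±1` encoded by a Boolean. -/
def signOf (b : Bool) : ℝ := if b then 1 else -1

@[simp] lemma signOf_true : signOf true = 1 := rfl
@[simp] lemma signOf_false : signOf false = -1 := by simp [signOf]
@[simp] lemma signOf_not (b : Bool) : signOf (!b) = -signOf b := by cases b <;> simp
lemma signOf_mul_self (b : Bool) : signOf b * signOf b = 1 := by cases b <;> simp
lemma abs_signOf (b : Bool) : |signOf b| = 1 := by cases b <;> simp

/-- Flip the sign of the coordinate `i`. -/
def flipAt {d : ℕ} (i : Fin d) (v : Fin d → Bool) : Fin d → Bool := Function.update v i (!v i)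

lemma flipAt_involutive {d : ℕ} (i : Fin d) : Function.Involutive (flipAt i) := by
  intro v
  simp [flipAt]

lemma signOf_flipAt {d : ℕ} (i : Fin d) (v : Fin d → Bool) :
    signOf (flipAt i v i) = -signOf (v i) := by simp [flipAt]

lemma sum_flipAt {d : ℕ} {M : Type*} [AddCommMonoid M] (i : Fin d) (F : (Fin d → Bool) → M) :
    ∑ v, F (flipAt i v) = ∑ v, F v :=
  Equiv.sum_comp (flipAt_involutive i).toPerm F

/-- The probability of the sign vector `s` when the signs are independent and the `i`-th one has
mean `γ v_i`. -/
noncomputable def signProb {d : ℕ} (γ : ℝ) (v s : Fin d → Bool) : ℝ :=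
  ∏ i, (1 + γ * signOf (v i) * signOf (s i)) / 2

/-- The centered coordinate `v_i s_i - γ`. -/
noncomputable def centered {d : ℕ} (γ : ℝ) (v s : Fin d → Bool) (i : Fin d) : ℝ :=
  signOf (v i) * signOf (s i) - γ

/-! ### Moments of independent biased signs -/

lemma sum_prod_bool {d : ℕ} (f : Fin d → Bool → ℝ) :
    ∑ s : Fin d → Bool, ∏ i, f i (s i) = ∏ i, (f i true + f i false) := by
  rw [← Fintype.prod_sum]
  simp

lemma signProb_nonneg {d : ℕ} {γ : ℝ} (h0 : 0 ≤ γ) (h1 : γ ≤ 1) (v s : Fin d → Bool) :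
    0 ≤ signProb γ v s := by
  refine Finset.prod_nonneg fun i _ => ?_
  cases v i <;> cases s i <;> simp <;> linarith

lemma sum_signProb {d : ℕ} (γ : ℝ) (v : Fin d → Bool) : ∑ s, signProb γ v s = 1 := by
  unfold signProb
  rw [sum_prod_bool (fun i b => (1 + γ * signOf (v i) * signOf b) / 2)]
  refine Finset.prod_eq_one fun i _ => ?_
  simp only [signOf_true, signOf_false]
  ring

lemma sum_signProb_centered {d : ℕ} (γ : ℝ) (v : Fin d → Bool) (i : Fin d) :
    ∑ s, signProb γ v s * centered γ v s i = 0 := by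
  have h : ∀ s : Fin d → Bool, signProb γ v s * centered γ v s i =
      ∏ k, ((1 + γ * signOf (v k) * signOf (s k)) / 2 *
        if k = i then signOf (v k) * signOf (s k) - γ else 1) := by
    intro s
    rw [Finset.prod_mul_distrib, Finset.prod_ite_eq']
    simp [signProb, centered]
  simp_rw [h]
  rw [sum_prod_bool (fun k b => (1 + γ * signOf (v k) * signOf b) / 2 *
        if k = i then signOf (v k) * signOf b - γ else 1)]
  refine Finset.prod_eq_zero (Finset.mem_univ i) ?_
  have := signOf_mul_self (v i)
  simp only [signOf_true, signOf_false, if_true]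
  linear_combination γ * this

/-- Independence makes distinct centered coordinates orthogonal, and each has the variance of a sign
of mean `±γ`. -/
lemma sum_signProb_centered_mul {d : ℕ} (γ : ℝ) (v : Fin d → Bool) (i j : Fin d) :
    ∑ s, signProb γ v s * (centered γ v s i * centered γ v s j) =
      if i = j then 1 - γ ^ 2 else 0 := by
  have h : ∀ s : Fin d → Bool, signProb γ v s * (centered γ v s i * centered γ v s j) =
      ∏ k, ((1 + γ * signOf (v k) * signOf (s k)) / 2 *
        ((if k = i then signOf (v k) * signOf (s k) - γ else 1) *
          if k = j then signOf (v k) * signOf (s k) - γ else 1)) := by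
    intro s
    rw [Finset.prod_mul_distrib, Finset.prod_mul_distrib, Finset.prod_ite_eq', Finset.prod_ite_eq']
    simp [signProb, centered]
  simp_rw [h]
  rw [sum_prod_bool (fun k b => (1 + γ * signOf (v k) * signOf b) / 2 *
        ((if k = i then signOf (v k) * signOf b - γ else 1) *
          if k = j then signOf (v k) * signOf b - γ else 1))]
  have hv := signOf_mul_self (v i)
  split_ifs with hij
  · subst hij
    rw [Finset.prod_eq_single i]
    · simp only [signOf_true, signOf_false, if_true]
      linear_combination (1 - 2 * γ ^ 2) * hv
    · intro k _ hk
      simp only [hk, if_false, signOf_true, signOf_false]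
      ring
    · simp
  · refine Finset.prod_eq_zero (Finset.mem_univ i) ?_
    simp only [signOf_true, signOf_false, if_true, if_neg hij]
    linear_combination γ * hv

lemma sum_signProb_signOf {d : ℕ} (γ : ℝ) (v : Fin d → Bool) (i : Fin d) :
    ∑ s, signProb γ v s * signOf (s i) = γ * signOf (v i) := by
  have h := sum_signProb_centered γ v i
  have h1 := sum_signProb γ v
  have hv := signOf_mul_self (v i)
  have h2 : ∀ s : Fin d → Bool, signProb γ v s * signOf (s i) =
      signOf (v i) * (signProb γ v s * centered γ v s i) + γ * signOf (v i) * signProb γ v s := by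
    intro s
    unfold centered
    linear_combination (-signProb γ v s * signOf (s i)) * hv
  simp_rw [h2]
  rw [Finset.sum_add_distrib, ← Finset.mul_sum, ← Finset.mul_sum, h, h1]
  ring

/-- Only the `i`-th factor changes. With `z = v_i s_i` and `z^2 = 1`, the likelihood ratio `(1 -
γz)/(1 + γz)` equals `(1 - γz)^2 / (1 - γ^2)`, which is affine in `z`. -/
lemma signProb_flipAt {d : ℕ} (γ : ℝ) (v s : Fin d → Bool) (i : Fin d) :
    (1 - γ ^ 2) * signProb γ (flipAt i v) s =
      signProb γ v s * (1 - γ ^ 2 - 2 * γ * centered γ v s i) := by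
  unfold signProb centered
  rw [← Finset.mul_prod_erase _ _ (Finset.mem_univ i),
    ← Finset.mul_prod_erase Finset.univ (fun k => (1 + γ * signOf (v k) * signOf (s k)) / 2)
      (Finset.mem_univ i)]
  have : ∏ k ∈ Finset.univ.erase i, (1 + γ * signOf (flipAt i v k) * signOf (s k)) / 2 =
      ∏ k ∈ Finset.univ.erase i, (1 + γ * signOf (v k) * signOf (s k)) / 2 := by
    refine Finset.prod_congr rfl fun k hk => ?_
    simp [flipAt, Function.update_of_ne (Finset.ne_of_mem_erase hk)]
  rw [this, signOf_flipAt]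
  have hz : (signOf (v i) * signOf (s i)) * (signOf (v i) * signOf (s i)) = 1 := by
    rw [mul_mul_mul_comm, signOf_mul_self, signOf_mul_self, one_mul]
  set z := signOf (v i) * signOf (s i)
  set R := ∏ k ∈ Finset.univ.erase i, (1 + γ * signOf (v k) * signOf (s k)) / 2
  rw [show γ * -signOf (v i) * signOf (s i) = -(γ * z) by simp only [z]; ring,
    show γ * signOf (v i) * signOf (s i) = γ * z by simp only [z]; ring]
  linear_combination R * γ ^ 2 * hz

/-- Bessel's inequality for the orthogonal system of centered coordinates. -/
lemma sum_sq_sum_centered_le {d : ℕ} {γ : ℝ} (h0 : 0 ≤ γ) (h1 : γ < 1) (v : Fin d → Bool)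
    (g : (Fin d → Bool) → ℝ) :
    ∑ i, (∑ s, signProb γ v s * (centered γ v s i * g s)) ^ 2 ≤
      (1 - γ ^ 2) * ∑ s, signProb γ v s * g s ^ 2 := by
  set σ := 1 - γ ^ 2 with hσ
  have hσ0 : 0 < σ := by nlinarith
  set c : Fin d → ℝ := fun i => ∑ s, signProb γ v s * (centered γ v s i * g s) with hc
  -- The residual of `g` after projection on the centered coordinates, multiplied by their common
  -- variance `σ` to avoid division.
  have key : 0 ≤ ∑ s, signProb γ v s * (σ * g s - ∑ i, c i * centered γ v s i) ^ 2 :=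
    Finset.sum_nonneg fun s _ => mul_nonneg (signProb_nonneg h0 h1.le v s) (sq_nonneg _)
  have e1 : ∑ s, signProb γ v s * (g s * ∑ i, c i * centered γ v s i) = ∑ i, c i ^ 2 := by
    simp_rw [Finset.mul_sum]
    rw [Finset.sum_comm]
    refine Finset.sum_congr rfl fun i _ => ?_
    rw [sq, hc]
    simp only
    rw [Finset.mul_sum]
    exact Finset.sum_congr rfl fun s _ => by ring
  have e2 : ∑ s, signProb γ v s * (∑ i, c i * centered γ v s i) ^ 2 = σ * ∑ i, c i ^ 2 := by
    have : ∀ s, signProb γ v s * (∑ i, c i * centered γ v s i) ^ 2 =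
        ∑ i, ∑ j, c i * c j * (signProb γ v s * (centered γ v s i * centered γ v s j)) := by
      intro s
      rw [sq, Finset.sum_mul_sum, Finset.mul_sum]
      refine Finset.sum_congr rfl fun i _ => ?_
      rw [Finset.mul_sum]
      exact Finset.sum_congr rfl fun j _ => by ring
    simp_rw [this]
    rw [Finset.sum_comm, Finset.mul_sum]
    refine Finset.sum_congr rfl fun i _ => ?_
    rw [Finset.sum_comm]
    simp_rw [← Finset.mul_sum, sum_signProb_centered_mul]
    simp
    ring
  have e3 : ∑ s, signProb γ v s * (σ * g s - ∑ i, c i * centered γ v s i) ^ 2 =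
      σ ^ 2 * ∑ s, signProb γ v s * g s ^ 2
        - 2 * σ * ∑ s, signProb γ v s * (g s * ∑ i, c i * centered γ v s i)
        + ∑ s, signProb γ v s * (∑ i, c i * centered γ v s i) ^ 2 := by
    rw [Finset.mul_sum, Finset.mul_sum, ← Finset.sum_sub_distrib, ← Finset.sum_add_distrib]
    exact Finset.sum_congr rfl fun s _ => by ring
  rw [e3, e1, e2] at key
  have : 0 ≤ σ * (σ * ∑ s, signProb γ v s * g s ^ 2 - ∑ i, c i ^ 2) := by linarith
  have := nonneg_of_mul_nonneg_right this hσ0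
  linarith

/-- The mean of `w` under the biased product measure. -/
noncomputable def signMean {d : ℕ} (γ : ℝ) (v : Fin d → Bool) (w : (Fin d → Bool) → ℝ) : ℝ :=
  ∑ s, signProb γ v s * w s

lemma signMean_nonneg {d : ℕ} {γ : ℝ} (h0 : 0 ≤ γ) (h1 : γ ≤ 1) (v : Fin d → Bool)
    {w : (Fin d → Bool) → ℝ} (hw : ∀ s, 0 ≤ w s) : 0 ≤ signMean γ v w :=
  Finset.sum_nonneg fun s _ => mul_nonneg (signProb_nonneg h0 h1 v s) (hw s)

/-- If `w` varies by at most the factor `E`, then all the `d` single sign flips together change its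
mean little. -/
lemma sum_sq_signMean_flipAt_sub_le {d : ℕ} {γ E : ℝ} (h0 : 0 ≤ γ) (h1 : γ < 1)
    (v : Fin d → Bool) {w : (Fin d → Bool) → ℝ} (hw : ∀ s, 0 ≤ w s)
    (hE : ∀ s s', w s ≤ E * w s') (hE1 : 1 ≤ E) :
    ∑ i, (signMean γ (flipAt i v) w - signMean γ v w) ^ 2 ≤
      4 * γ ^ 2 / (1 - γ ^ 2) * (E - 1) ^ 2 * signMean γ v w ^ 2 := by
  set m := signMean γ v w with hm
  have hσ0 : 0 < 1 - γ ^ 2 := by nlinarith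
  have hp := fun s => signProb_nonneg h0 h1.le v s
  have hm0 : 0 ≤ m := signMean_nonneg h0 h1.le v hw
  -- Subtracting `m` is free because the centered coordinates have mean zero; it brings in the
  -- variance of `w` instead of its second moment.
  have hdiff : ∀ i, signMean γ (flipAt i v) w - m =
      -(2 * γ / (1 - γ ^ 2)) * ∑ s, signProb γ v s * (centered γ v s i * (w s - m)) := by
    intro i
    have a : (1 - γ ^ 2) * signMean γ (flipAt i v) w =
        (1 - γ ^ 2) * m - 2 * γ * ∑ s, signProb γ v s * (centered γ v s i * w s) := by
      simp only [hm, signMean, Finset.mul_sum]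
      rw [← Finset.sum_sub_distrib]
      refine Finset.sum_congr rfl fun s _ => ?_
      rw [← mul_assoc, signProb_flipAt]
      ring
    have b : ∑ s, signProb γ v s * (centered γ v s i * (w s - m)) =
        ∑ s, signProb γ v s * (centered γ v s i * w s) := by
      have c := sum_signProb_centered γ v i
      have : ∀ s, signProb γ v s * (centered γ v s i * (w s - m)) =
          signProb γ v s * (centered γ v s i * w s) - m * (signProb γ v s * centered γ v s i) :=
        fun s => by ring
      simp_rw [this]
      rw [Finset.sum_sub_distrib, ← Finset.mul_sum, c]
      ring
    rw [b]
    refine mul_left_cancel₀ hσ0.ne' ?_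
    rw [mul_sub, a, ← mul_assoc, mul_neg, mul_div_cancel₀ _ hσ0.ne']
    ring
  have hdev : ∀ s, (w s - m) ^ 2 ≤ ((E - 1) * m) ^ 2 := by
    intro s
    have u1 : w s ≤ E * m := by
      calc w s = ∑ s', signProb γ v s' * w s := by rw [← Finset.sum_mul, sum_signProb, one_mul]
        _ ≤ ∑ s', signProb γ v s' * (E * w s') :=
            Finset.sum_le_sum fun s' _ => mul_le_mul_of_nonneg_left (hE s s') (hp s')
        _ = E * m := by
            rw [hm, signMean, Finset.mul_sum]
            exact Finset.sum_congr rfl fun _ _ => by ring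
    have u2 : m ≤ E * w s := by
      calc m ≤ ∑ s', signProb γ v s' * (E * w s) :=
            Finset.sum_le_sum fun s' _ => mul_le_mul_of_nonneg_left (hE s' s) (hp s')
        _ = E * w s := by rw [← Finset.sum_mul, sum_signProb, one_mul]
    refine sq_le_sq' ?_ (by linarith)
    by_cases hws : w s ≤ m
    · nlinarith
    · nlinarith [not_le.mp hws]
  calc ∑ i, (signMean γ (flipAt i v) w - m) ^ 2
      = (2 * γ / (1 - γ ^ 2)) ^ 2 *
          ∑ i, (∑ s, signProb γ v s * (centered γ v s i * (w s - m))) ^ 2 := by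
        rw [Finset.mul_sum]
        exact Finset.sum_congr rfl fun i _ => by rw [hdiff]; ring
    _ ≤ (2 * γ / (1 - γ ^ 2)) ^ 2 *
          ((1 - γ ^ 2) * ∑ s, signProb γ v s * (w s - m) ^ 2) :=
        mul_le_mul_of_nonneg_left (sum_sq_sum_centered_le h0 h1 v _) (sq_nonneg _)
    _ ≤ (2 * γ / (1 - γ ^ 2)) ^ 2 *
          ((1 - γ ^ 2) * ∑ s, signProb γ v s * ((E - 1) * m) ^ 2) := by
        refine mul_le_mul_of_nonneg_left (mul_le_mul_of_nonneg_left ?_ hσ0.le) (sq_nonneg _)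
        exact Finset.sum_le_sum fun s _ => mul_le_mul_of_nonneg_left (hdev s) (hp s)
    _ = 4 * γ ^ 2 / (1 - γ ^ 2) * (E - 1) ^ 2 * m ^ 2 := by
        rw [← Finset.sum_mul, sum_signProb]
        field_simp
        ring

/-! ### Pointwise inequalities for affinities -/

lemma sq_sqrt_sub_sqrt_mul_le {a b : ℝ} (ha : 0 ≤ a) (hb : 0 ≤ b) :
    (√b - √a) ^ 2 * a ≤ (b - a) ^ 2 := by
  have h1 := Real.sq_sqrt ha
  have h2 := Real.sq_sqrt hb
  have h3 : (b - a) ^ 2 = (√b - √a) ^ 2 * (√b + √a) ^ 2 := by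
    rw [← mul_pow]
    congr 1
    nlinarith
  rw [h3]
  refine mul_le_mul_of_nonneg_left ?_ (sq_nonneg _)
  nlinarith [Real.sqrt_nonneg a, Real.sqrt_nonneg b, mul_nonneg (Real.sqrt_nonneg a) (Real.sqrt_nonneg b)]

/-- Squared Hellinger distances between the neighbours of a mean, pointwise. -/
lemma sum_sq_sqrt_signMean_sub_le {d : ℕ} {γ E : ℝ} (h0 : 0 ≤ γ) (h1 : γ < 1)
    (v : Fin d → Bool) {w : (Fin d → Bool) → ℝ} (hw : ∀ s, 0 ≤ w s)
    (hE : ∀ s s', w s ≤ E * w s') (hE1 : 1 ≤ E) :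
    ∑ i, (√(signMean γ (flipAt i v) w) - √(signMean γ v w)) ^ 2 ≤
      4 * γ ^ 2 / (1 - γ ^ 2) * (E - 1) ^ 2 * signMean γ v w := by
  have hm0 : 0 ≤ signMean γ v w := signMean_nonneg h0 h1.le v hw
  have hb := fun i => signMean_nonneg h0 h1.le (flipAt i v) hw
  have hσ0 : 0 < 1 - γ ^ 2 := by nlinarith
  have h := sum_sq_signMean_flipAt_sub_le h0 h1 v hw hE hE1
  -- The bound on squared differences is to be divided by the mean. If the mean vanishes, the ratio
  -- bound forces `w = 0`.
  rcases hm0.eq_or_lt with hz | hpos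
  · have hw0 : ∀ s, w s = 0 := by
      by_contra! hne
      obtain ⟨s, hs⟩ := hne
      have hs' : 0 < w s := lt_of_le_of_ne (hw s) (Ne.symm hs)
      have : w s ≤ E * signMean γ v w := by
        calc w s = ∑ s', signProb γ v s' * w s := by rw [← Finset.sum_mul, sum_signProb, one_mul]
        _ ≤ ∑ s', signProb γ v s' * (E * w s') :=
            Finset.sum_le_sum fun s' _ =>
              mul_le_mul_of_nonneg_left (hE s s') (signProb_nonneg h0 h1.le v s')
        _ = E * signMean γ v w := by
            rw [signMean, Finset.mul_sum]
            exact Finset.sum_congr rfl fun _ _ => by ring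
      rw [← hz] at this
      linarith
    simp [signMean, hw0]
  · refine le_of_mul_le_mul_right ?_ hpos
    rw [Finset.sum_mul]
    calc _ ≤ ∑ i, (signMean γ (flipAt i v) w - signMean γ v w) ^ 2 :=
          Finset.sum_le_sum fun i _ => sq_sqrt_sub_sqrt_mul_le hpos.le (hb i)
      _ ≤ _ := h
      _ = _ := by ring

/-- The pointwise form of the growth of Hellinger affinities under one more observation. -/
lemma sum_sqrt_mul_add_le {d : ℕ} {γ E : ℝ} (h0 : 0 ≤ γ) (h1 : γ < 1)
    {l w : (Fin d → Bool) → ℝ} (hl : ∀ v, 0 ≤ l v) (hw : ∀ s, 0 ≤ w s)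
    (hE : ∀ s s', w s ≤ E * w s') (hE1 : 1 ≤ E) :
    ∑ i, ∑ v, √(l v * l (flipAt i v)) * ((signMean γ v w + signMean γ (flipAt i v) w) / 2) ≤
      (∑ i, ∑ v, √((l v * signMean γ v w) * (l (flipAt i v) * signMean γ (flipAt i v) w))) +
        2 * γ ^ 2 / (1 - γ ^ 2) * (E - 1) ^ 2 * ∑ v, l v * signMean γ v w := by
  have hm := fun v => signMean_nonneg h0 h1.le v hw
  set m := fun v => signMean γ v w with hmdef
  set q : Fin d → (Fin d → Bool) → ℝ := fun i v => (√(m (flipAt i v)) - √(m v)) ^ 2 with hq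
  have pt : ∀ i v, √(l v * l (flipAt i v)) * ((m v + m (flipAt i v)) / 2) ≤
      √((l v * m v) * (l (flipAt i v) * m (flipAt i v))) +
        (l v + l (flipAt i v)) / 4 * q i v := by
    intro i v
    have e1 : √((l v * m v) * (l (flipAt i v) * m (flipAt i v))) =
        √(l v * l (flipAt i v)) * (√(m v) * √(m (flipAt i v))) := by
      rw [← Real.sqrt_mul (hm v), ← Real.sqrt_mul (mul_nonneg (hl _) (hl _))]
      congr 1
      ring
    -- The arithmetic mean exceeds the geometric mean by half the squared difference of the roots:
    -- this excess is the affinity lost.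
    have e2 : (m v + m (flipAt i v)) / 2 = √(m v) * √(m (flipAt i v)) + q i v / 2 := by
      have := Real.sq_sqrt (hm v)
      have := Real.sq_sqrt (hm (flipAt i v))
      simp only [hq]
      nlinarith
    have e3 : √(l v * l (flipAt i v)) ≤ (l v + l (flipAt i v)) / 2 := by
      rw [Real.sqrt_le_left (by linarith [hl v, hl (flipAt i v)])]
      nlinarith [sq_nonneg (l v - l (flipAt i v))]
    rw [e1, e2, mul_add]
    have : 0 ≤ q i v := sq_nonneg _
    nlinarith
  -- The flip is a bijection that exchanges the two likelihoods and preserves `q i`.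
  have sym : ∀ i, ∑ v, (l v + l (flipAt i v)) / 4 * q i v = ∑ v, l v / 2 * q i v := by
    intro i
    have : ∑ v, l (flipAt i v) / 4 * q i v = ∑ v, l v / 4 * q i v := by
      rw [← sum_flipAt i (fun v => l v / 4 * q i v)]
      refine Finset.sum_congr rfl fun v _ => ?_
      simp only [hq, flipAt_involutive i v]
      ring
    calc _ = ∑ v, l v / 4 * q i v + ∑ v, l (flipAt i v) / 4 * q i v := by
          rw [← Finset.sum_add_distrib]
          exact Finset.sum_congr rfl fun _ _ => by ring
      _ = _ := by
          rw [this, ← Finset.sum_add_distrib]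
          exact Finset.sum_congr rfl fun _ _ => by ring
  calc _ ≤ ∑ i, ∑ v, (√((l v * m v) * (l (flipAt i v) * m (flipAt i v))) +
        (l v + l (flipAt i v)) / 4 * q i v) :=
        Finset.sum_le_sum fun i _ => Finset.sum_le_sum fun v _ => pt i v
    _ = (∑ i, ∑ v, √((l v * m v) * (l (flipAt i v) * m (flipAt i v)))) +
        ∑ v, l v / 2 * ∑ i, q i v := by
        simp_rw [Finset.sum_add_distrib, sym]
        rw [Finset.sum_comm (f := fun i v => l v / 2 * q i v)]
        simp_rw [Finset.mul_sum]
    _ ≤ _ := by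
        gcongr
        rw [Finset.mul_sum]
        refine Finset.sum_le_sum fun v _ => ?_
        have := mul_le_mul_of_nonneg_left (sum_sq_sqrt_signMean_sub_le h0 h1 v hw hE hE1)
          (div_nonneg (hl v) zero_le_two)
        refine this.trans (le_of_eq ?_)
        ring

/-- Two likelihoods that have a large affinity cannot both be small. -/
lemma sqrt_mul_le_min {a b : ℝ} (ha : 0 ≤ a) (hb : 0 ≤ b) :
    3 / 4 * √(a * b) ≤ min a b + (a + b) / 8 := by
  rw [Real.sqrt_mul ha]
  have h1 := Real.sq_sqrt ha
  have h2 := Real.sq_sqrt hb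
  rcases le_total a b with h | h
  · rw [min_eq_left h]
    -- The difference of the two sides is exactly `(3√a - √b)^2 / 8`.
    nlinarith [sq_nonneg (3 * √a - √b)]
  · rw [min_eq_right h]
    nlinarith [sq_nonneg (3 * √b - √a)]

/-- The pointwise form of the testing lower bound. -/
lemma sum_sqrt_le_sum_loss {d : ℕ} {l : (Fin d → Bool) → ℝ} (hl : ∀ v, 0 ≤ l v) {b : ℝ}
    {x : Fin d → ℝ} (hx : ∀ i, |x i| ≤ b) :
    3 / 4 * b * ∑ i, ∑ v, √(l v * l (flipAt i v)) ≤
      ∑ v, l v * ∑ i, (b + signOf (v i) * x i) + d * b / 4 * ∑ v, l v := by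
  have pt : ∀ i, 3 / 4 * b * ∑ v, √(l v * l (flipAt i v)) ≤
      ∑ v, l v * (b + signOf (v i) * x i) + b / 4 * ∑ v, l v := by
    intro i
    obtain ⟨hx1, hx2⟩ := abs_le.mp (hx i)
    have hb : 0 ≤ b := (abs_nonneg _).trans (hx i)
    have e : ∑ v, l (flipAt i v) * (b - signOf (v i) * x i) =
        ∑ v, l v * (b + signOf (v i) * x i) := by
      rw [← sum_flipAt i (fun v => l v * (b + signOf (v i) * x i))]
      refine Finset.sum_congr rfl fun v _ => ?_
      rw [signOf_flipAt]
      ring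
    have e' : ∑ v, l (flipAt i v) = ∑ v, l v := sum_flipAt i l
    -- The losses of coordinate `i` under `v` and under its flip are nonnegative with sum `2b`, so
    -- their weighted sum is at least `2b` times the smaller likelihood.
    have : ∑ v, 2 * (3 / 4 * b * √(l v * l (flipAt i v))) ≤
        ∑ v, (l v * (b + signOf (v i) * x i) + l (flipAt i v) * (b - signOf (v i) * x i)
          + (b / 4 * l v + b / 4 * l (flipAt i v))) := by
      refine Finset.sum_le_sum fun v _ => ?_
      have h := mul_le_mul_of_nonneg_left (sqrt_mul_le_min (hl v) (hl (flipAt i v))) hb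
      have hs : -b ≤ signOf (v i) * x i ∧ signOf (v i) * x i ≤ b := by
        cases v i <;> simp <;> constructor <;> linarith
      have a1 := mul_le_mul_of_nonneg_right (min_le_left (l v) (l (flipAt i v)))
        (by linarith [hs.1] : 0 ≤ b + signOf (v i) * x i)
      have a2 := mul_le_mul_of_nonneg_right (min_le_right (l v) (l (flipAt i v)))
        (by linarith [hs.2] : 0 ≤ b - signOf (v i) * x i)
      nlinarith
    rw [Finset.sum_add_distrib, Finset.sum_add_distrib, Finset.sum_add_distrib, e,
      ← Finset.mul_sum, ← Finset.mul_sum, ← Finset.mul_sum, ← Finset.mul_sum, e'] at this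
    linarith
  calc _ = ∑ i, 3 / 4 * b * ∑ v, √(l v * l (flipAt i v)) := by rw [Finset.mul_sum]
    _ ≤ ∑ i, (∑ v, l v * (b + signOf (v i) * x i) + b / 4 * ∑ v, l v) :=
        Finset.sum_le_sum fun i _ => pt i
    _ = _ := by
        rw [Finset.sum_add_distrib, Finset.sum_comm]
        simp_rw [← Finset.mul_sum]
        simp only [Finset.sum_const, Finset.card_univ, Fintype.card_fin, nsmul_eq_mul]
        ring


section Affinity

/-! ### Affinities of families of laws indexed by the sign cube -/

/-- The laws `μ v`, `v ∈ {±1}^d`, have densities with respect to a common probability measure, and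
the Hellinger affinities of the `d 2^d` neighbouring pairs sum to at least `d 2^d - C`. -/
def AffinityBound {d : ℕ} {α : Type*} [MeasurableSpace α] (μ : (Fin d → Bool) → Measure α)
    (C : ℝ≥0∞) : Prop :=
  ∃ (ν : Measure α) (L : (Fin d → Bool) → α → ℝ), IsProbabilityMeasure ν ∧
    (∀ v, Measurable (L v)) ∧ (∀ v a, 0 ≤ L v a) ∧
    (∀ v, μ v = ν.withDensity fun a => ENNReal.ofReal (L v a)) ∧
    (d * 2 ^ d : ℝ≥0∞) ≤
      (∑ i, ∑ v, ∫⁻ a, ENNReal.ofReal √(L v a * L (flipAt i v) a) ∂ν) + C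

variable {d : ℕ} {α β : Type*} [MeasurableSpace α] [MeasurableSpace β]

lemma affinityBound_const (ν : Measure α) [IsProbabilityMeasure ν] :
    AffinityBound (fun _ : Fin d → Bool => ν) 0 := by
  refine ⟨ν, fun _ _ => 1, inferInstance, fun _ => measurable_const, fun _ _ => zero_le_one,
    fun v => by simp, ?_⟩
  simp

/-- A measurable left inverse makes `f` a lossless recoding, so the densities can be transported
along `g`. -/
lemma AffinityBound.map {μ : (Fin d → Bool) → Measure α} {C : ℝ≥0∞} (h : AffinityBound μ C)
    {f : α → β} {g : β → α} (hf : Measurable f) (hg : Measurable g) (hgf : ∀ a, g (f a) = a) :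
    AffinityBound (fun v => (μ v).map f) C := by
  obtain ⟨ν, L, hν, hL, hL0, hμ, hC⟩ := h
  refine ⟨ν.map f, fun v b => L v (g b), Measure.isProbabilityMeasure_map hf.aemeasurable,
    fun v => (hL v).comp hg, fun v b => hL0 v _, fun v => ?_, ?_⟩
  · ext S hS
    rw [Measure.map_apply hf hS, hμ, withDensity_apply _ (hf hS), withDensity_apply _ hS,
      setLIntegral_map (f := fun b => ENNReal.ofReal (L v (g b))) hS
        ((hL v).comp hg).ennreal_ofReal hf]
    simp [hgf]
  · refine hC.trans (le_of_eq ?_)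
    congr 1
    refine Finset.sum_congr rfl fun i _ => Finset.sum_congr rfl fun v _ => ?_
    rw [lintegral_map ?_ hf]
    · simp [hgf]
    · exact ((((hL v).comp hg).mul ((hL _).comp hg)).sqrt).ennreal_ofReal

lemma ofReal_signMean {γ : ℝ} (h0 : 0 ≤ γ) (h1 : γ ≤ 1) (v : Fin d → Bool)
    {w : (Fin d → Bool) → ℝ} (hw : ∀ s, 0 ≤ w s) :
    ENNReal.ofReal (signMean γ v w) =
      ∑ s, ENNReal.ofReal (signProb γ v s) * ENNReal.ofReal (w s) := by
  rw [signMean, ENNReal.ofReal_sum_of_nonneg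
    fun s _ => mul_nonneg (signProb_nonneg h0 h1 v s) (hw s)]
  exact Finset.sum_congr rfl fun s _ => ENNReal.ofReal_mul (signProb_nonneg h0 h1 v s)

lemma compProd_withDensity_withDensity {μ ν : Measure α} [SFinite μ] [SFinite ν]
    {κ ρ : Kernel α β} [IsSFiniteKernel κ] [IsSFiniteKernel ρ] {f : α → ℝ≥0∞}
    {g : α × β → ℝ≥0∞} (hf : Measurable f) (hg : Measurable g) (hμ : μ = ν.withDensity f)
    (hκ : ∀ a, κ a = (ρ a).withDensity fun y => g (a, y)) :
    μ ⊗ₘ κ = (ν ⊗ₘ ρ).withDensity fun z => f z.1 * g z := by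
  ext S hS
  rw [Measure.compProd_apply hS, withDensity_apply _ hS, ← lintegral_indicator hS,
    Measure.lintegral_compProd (f := S.indicator fun z => f z.1 * g z)
      (((hf.comp measurable_fst).mul hg).indicator hS), hμ,
    lintegral_withDensity_eq_lintegral_mul _ hf (Kernel.measurable_kernel_prodMk_left hS)]
  refine lintegral_congr fun a => ?_
  have hSa : MeasurableSet (Prod.mk a ⁻¹' S) := measurable_prodMk_left hS
  rw [Pi.mul_apply, hκ, withDensity_apply _ hSa, ← lintegral_indicator hSa,
    ← lintegral_const_mul _ (Measurable.indicator (f := fun y => g (a, y))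
      (hg.comp measurable_prodMk_left) hSa)]
  refine lintegral_congr fun y => ?_
  by_cases hy : (a, y) ∈ S
  · simp [hy]
  · simp [hy]

/-- Jointly measurable densities of finitely many kernels that pairwise dominate each other. -/
lemma exists_densities [MeasurableSpace.CountableOrCountablyGenerated α β] {ι : Type*} [Finite ι]
    (K : ι → Kernel α β) [∀ s, IsMarkovKernel (K s)] {E : ℝ} (hE : 0 ≤ E)
    (hK : ∀ s s' a S, MeasurableSet S → K s a S ≤ ENNReal.ofReal E * K s' a S) (s₀ : ι) :
    ∃ w : ι → α × β → ℝ, (∀ s, Measurable (w s)) ∧ (∀ s z, 0 ≤ w s z) ∧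
      (∀ s a, K s a = (K s₀ a).withDensity fun y => ENNReal.ofReal (w s (a, y))) ∧
      ∀ a, ∀ᵐ y ∂(K s₀ a), ∀ s s', w s (a, y) ≤ E * w s' (a, y) := by
  have hac : ∀ s a, K s a ≪ K s₀ a := by
    intro s a
    refine Measure.AbsolutelyContinuous.mk fun S hS h0 => ?_
    have := hK s s₀ a S hS
    rw [h0, mul_zero] at this
    exact le_antisymm this (zero_le)
  have hdens : ∀ s a, K s a = (K s₀ a).withDensity
      fun y => ENNReal.ofReal (Kernel.rnDeriv (K s) (K s₀) a y).toReal := by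
    intro s a
    have h1 := Kernel.withDensity_rnDeriv_eq (hac s a)
    rw [Kernel.withDensity_apply _ (Kernel.measurable_rnDeriv _ _)] at h1
    conv_lhs => rw [← h1]
    refine withDensity_congr_ae ?_
    filter_upwards [Kernel.rnDeriv_ne_top (K s) (K s₀) (a := a)] with y hy
    rw [ENNReal.ofReal_toReal hy]
  have hmeas : ∀ s, Measurable fun z : α × β => (Kernel.rnDeriv (K s) (K s₀) z.1 z.2).toReal :=
    fun s => (Kernel.measurable_rnDeriv (K s) (K s₀)).ennreal_toReal
  refine ⟨fun s z => (Kernel.rnDeriv (K s) (K s₀) z.1 z.2).toReal, hmeas,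
    fun s z => ENNReal.toReal_nonneg, hdens, fun a => ?_⟩
  rw [ae_all_iff]
  intro s
  rw [ae_all_iff]
  intro s'
  have hm : ∀ s, Measurable fun y => (Kernel.rnDeriv (K s) (K s₀) a y).toReal :=
    fun s => (hmeas s).comp measurable_prodMk_left
  -- Domination on all measurable sets passes to the densities almost everywhere.
  have := ae_le_of_forall_setLIntegral_le_of_sigmaFinite (μ := K s₀ a)
    (f := fun y => ENNReal.ofReal (Kernel.rnDeriv (K s) (K s₀) a y).toReal)
    (g := fun y => ENNReal.ofReal E * ENNReal.ofReal (Kernel.rnDeriv (K s') (K s₀) a y).toReal)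
    (hm s).ennreal_ofReal (fun S hS _ => by
      rw [lintegral_const_mul _ (hm s').ennreal_ofReal, ← withDensity_apply _ hS,
        ← withDensity_apply _ hS, ← hdens, ← hdens]
      exact hK s s' a S hS)
  filter_upwards [this] with y hy
  rw [← ENNReal.ofReal_mul hE] at hy
  exact (ENNReal.ofReal_le_ofReal_iff (mul_nonneg hE ENNReal.toReal_nonneg)).mp hy

/-- One more observation through a locally private channel decreases affinities little. -/
lemma AffinityBound.compProd [MeasurableSpace.CountableOrCountablyGenerated α β]
    {μ : (Fin d → Bool) → Measure α} [∀ v, IsProbabilityMeasure (μ v)] {C : ℝ≥0∞}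
    (h : AffinityBound μ C) {γ E : ℝ} (h0 : 0 ≤ γ) (h1 : γ < 1) (hE1 : 1 ≤ E)
    (K : (Fin d → Bool) → Kernel α β) [∀ s, IsMarkovKernel (K s)]
    (hK : ∀ s s' a S, MeasurableSet S → K s a S ≤ ENNReal.ofReal E * K s' a S)
    (κ : (Fin d → Bool) → Kernel α β) [∀ v, IsMarkovKernel (κ v)]
    (hκ : ∀ v a, κ v a = ∑ s, ENNReal.ofReal (signProb γ v s) • K s a) :
    AffinityBound (fun v => μ v ⊗ₘ κ v)
      (C + ENNReal.ofReal (2 * γ ^ 2 / (1 - γ ^ 2) * (E - 1) ^ 2) * 2 ^ d) := by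
  obtain ⟨ν, L, hν, hL, hL0, hμ, hC⟩ := h
  obtain ⟨w, hw, hw0, hKw, hwE⟩ := exists_densities K (zero_le_one.trans hE1) hK (fun _ => true)
  set ρ := K fun _ => true
  set m : (Fin d → Bool) → α × β → ℝ := fun v z => signMean γ v fun s => w s z with hm
  have hmm : ∀ v, Measurable (m v) := fun v =>
    Finset.measurable_fun_sum _ fun s _ => (hw s).const_mul _
  have hm0 : ∀ v z, 0 ≤ m v z := fun v z => signMean_nonneg h0 h1.le v fun s => hw0 s z
  have hκm : ∀ v a, κ v a = (ρ a).withDensity fun y => ENNReal.ofReal (m v (a, y)) := by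
    intro v a
    ext S hS
    have hws : ∀ s, Measurable fun y => ENNReal.ofReal (w s (a, y)) :=
      fun s => ((hw s).comp measurable_prodMk_left).ennreal_ofReal
    rw [hκ, withDensity_apply _ hS]
    simp only [hm, ofReal_signMean h0 h1.le v fun s => hw0 s _]
    rw [lintegral_finsetSum _ fun s _ => (hws s).const_mul _]
    simp only [Measure.coe_finsetSum, Finset.sum_apply, Measure.smul_apply, smul_eq_mul]
    refine Finset.sum_congr rfl fun s _ => ?_
    rw [lintegral_const_mul _ (hws s), hKw s a, withDensity_apply _ hS]
  have hm1 : ∀ v a, ∫⁻ y, ENNReal.ofReal (m v (a, y)) ∂(ρ a) = 1 := by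
    intro v a
    have := hκm v a
    rw [← setLIntegral_univ, ← withDensity_apply _ MeasurableSet.univ, ← this, measure_univ]
  have hjoint : ∀ v, μ v ⊗ₘ κ v =
      (ν ⊗ₘ ρ).withDensity fun z => ENNReal.ofReal (L v z.1 * m v z) := by
    intro v
    rw [compProd_withDensity_withDensity (f := fun a => ENNReal.ofReal (L v a))
      (g := fun z => ENNReal.ofReal (m v z)) (hL v).ennreal_ofReal (hmm v).ennreal_ofReal (hμ v)
      (hκm v)]
    simp_rw [ENNReal.ofReal_mul (hL0 v _)]
  refine ⟨ν ⊗ₘ ρ, fun v z => L v z.1 * m v z, inferInstance,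
    fun v => ((hL v).comp measurable_fst).mul (hmm v), fun v z => mul_nonneg (hL0 v _) (hm0 v z),
    hjoint, ?_⟩
  set c := 2 * γ ^ 2 / (1 - γ ^ 2) * (E - 1) ^ 2
  have hc : 0 ≤ c := mul_nonneg (div_nonneg (by positivity) (by nlinarith)) (sq_nonneg _)
  have hLm : ∀ v, Measurable fun z : α × β => L v z.1 := fun v => (hL v).comp measurable_fst
  -- The conditional densities integrate to 1, so inserting their average leaves the old affinity
  -- unchanged and puts it on the space of the new one.
  have hA : ∀ i v, ∫⁻ a, ENNReal.ofReal √(L v a * L (flipAt i v) a) ∂ν =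
      ∫⁻ z, ENNReal.ofReal (√(L v z.1 * L (flipAt i v) z.1) * ((m v z + m (flipAt i v) z) / 2))
        ∂(ν ⊗ₘ ρ) := by
    intro i v
    rw [Measure.lintegral_compProd (f := fun z => ENNReal.ofReal
        (√(L v z.1 * L (flipAt i v) z.1) * ((m v z + m (flipAt i v) z) / 2)))
      (((hLm v).mul (hLm _)).sqrt.mul (((hmm v).add (hmm _)).div_const 2)).ennreal_ofReal]
    refine lintegral_congr fun a => ?_
    have e : ∀ v, Measurable fun y => ENNReal.ofReal (m v (a, y)) :=
      fun v => ((hmm v).comp measurable_prodMk_left).ennreal_ofReal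
    have : ∀ y, ENNReal.ofReal (√(L v a * L (flipAt i v) a) *
        ((m v (a, y) + m (flipAt i v) (a, y)) / 2)) = ENNReal.ofReal √(L v a * L (flipAt i v) a) *
        ((ENNReal.ofReal (m v (a, y)) + ENNReal.ofReal (m (flipAt i v) (a, y))) / 2) := by
      intro y
      rw [ENNReal.ofReal_mul (Real.sqrt_nonneg _), ENNReal.ofReal_div_of_pos zero_lt_two,
        ENNReal.ofReal_add (hm0 _ _) (hm0 _ _)]
      simp
    simp_rw [this, div_eq_mul_inv]
    rw [lintegral_const_mul' _ _ ENNReal.ofReal_ne_top, lintegral_mul_const' _ _ (by simp),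
      lintegral_add_left (e _), hm1, hm1,
      one_add_one_eq_two, ENNReal.mul_inv_cancel two_ne_zero ENNReal.ofNat_ne_top, mul_one]
  have hB : ∀ v, ∫⁻ z, ENNReal.ofReal (L v z.1 * m v z) ∂(ν ⊗ₘ ρ) = 1 := by
    intro v
    rw [← setLIntegral_univ, ← withDensity_apply _ MeasurableSet.univ, ← hjoint, measure_univ]
  have hae : ∀ᵐ z ∂(ν ⊗ₘ ρ), ∀ s s', w s z ≤ E * w s' z := by
    rw [Measure.ae_compProd_iff]
    · exact Filter.Eventually.of_forall hwE
    · simp only [Set.ofPred_forall]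
      refine MeasurableSet.iInter fun s => MeasurableSet.iInter fun s' => ?_
      exact measurableSet_le (hw s) ((hw s').const_mul E)
  have main : ∑ i, ∑ v, ∫⁻ z, ENNReal.ofReal
        (√(L v z.1 * L (flipAt i v) z.1) * ((m v z + m (flipAt i v) z) / 2)) ∂(ν ⊗ₘ ρ) ≤
      (∑ i, ∑ v, ∫⁻ z, ENNReal.ofReal √(L v z.1 * m v z * (L (flipAt i v) z.1 * m (flipAt i v) z))
        ∂(ν ⊗ₘ ρ)) + ENNReal.ofReal c * 2 ^ d := by
    have f1 : ∀ i v, Measurable fun z : α × β => ENNReal.ofReal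
        (√(L v z.1 * L (flipAt i v) z.1) * ((m v z + m (flipAt i v) z) / 2)) := fun i v =>
      (((hLm v).mul (hLm _)).sqrt.mul (((hmm v).add (hmm _)).div_const 2)).ennreal_ofReal
    have f2 : ∀ i v, Measurable fun z : α × β => ENNReal.ofReal
        √(L v z.1 * m v z * (L (flipAt i v) z.1 * m (flipAt i v) z)) := fun i v =>
      ((((hLm v).mul (hmm v)).mul ((hLm _).mul (hmm _))).sqrt).ennreal_ofReal
    have f3 : ∀ v, Measurable fun z : α × β => ENNReal.ofReal (L v z.1 * m v z) := fun v =>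
      ((hLm v).mul (hmm v)).ennreal_ofReal
    have e3 : ENNReal.ofReal c * 2 ^ d =
        ∫⁻ z, ENNReal.ofReal c * ∑ v, ENNReal.ofReal (L v z.1 * m v z) ∂(ν ⊗ₘ ρ) := by
      rw [lintegral_const_mul _ (Finset.measurable_fun_sum _ fun v _ => f3 v),
        lintegral_finsetSum _ fun v _ => f3 v]
      simp [hB]
    have e1 : ∀ F : Fin d → (Fin d → Bool) → α × β → ℝ≥0∞, (∀ i v, Measurable (F i v)) →
        ∑ i, ∑ v, ∫⁻ z, F i v z ∂(ν ⊗ₘ ρ) = ∫⁻ z, ∑ i, ∑ v, F i v z ∂(ν ⊗ₘ ρ) := by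
      intro F hF
      rw [lintegral_finsetSum _ fun i _ => Finset.measurable_fun_sum _ fun v _ => hF i v]
      exact Finset.sum_congr rfl fun i _ => (lintegral_finsetSum _ fun v _ => hF i v).symm
    rw [e1 _ f1, e1 _ f2, e3, ← lintegral_add_left (Finset.measurable_fun_sum _ fun i _ =>
      Finset.measurable_fun_sum _ fun v _ => f2 i v)]
    refine lintegral_mono_ae ?_
    filter_upwards [hae] with z hz
    have key := sum_sqrt_mul_add_le h0 h1 (l := fun v => L v z.1) (w := fun s => w s z)
      (fun v => hL0 v _) (fun s => hw0 s z) hz hE1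
    have key' := ENNReal.ofReal_le_ofReal key
    have p1 : ∀ i v, 0 ≤ √(L v z.1 * L (flipAt i v) z.1) * ((m v z + m (flipAt i v) z) / 2) :=
      fun i v => mul_nonneg (Real.sqrt_nonneg _) (by linarith [hm0 v z, hm0 (flipAt i v) z])
    have p3 : ∀ v, 0 ≤ L v z.1 * m v z := fun v => mul_nonneg (hL0 v _) (hm0 v z)
    rw [ENNReal.ofReal_add (Finset.sum_nonneg fun i _ => Finset.sum_nonneg fun v _ =>
        Real.sqrt_nonneg _) (mul_nonneg hc (Finset.sum_nonneg fun v _ => p3 v)),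
      ENNReal.ofReal_mul hc, ENNReal.ofReal_sum_of_nonneg fun v _ => p3 v,
      ENNReal.ofReal_sum_of_nonneg fun i _ => Finset.sum_nonneg fun v _ => p1 i v,
      ENNReal.ofReal_sum_of_nonneg fun i _ => Finset.sum_nonneg fun v _ => Real.sqrt_nonneg _]
      at key'
    simp_rw [ENNReal.ofReal_sum_of_nonneg fun v _ => p1 _ v,
      ENNReal.ofReal_sum_of_nonneg fun v _ => Real.sqrt_nonneg _] at key'
    exact key'
  simp_rw [hA] at hC
  calc _ ≤ _ := hC
    _ ≤ _ := add_le_add_left main C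
    _ = _ := by ring

/-- The testing lower bound: when the affinities are large, no point is good for most `v`. -/
lemma AffinityBound.le_sum_loss {μ : (Fin d → Bool) → Measure α} [∀ v, IsProbabilityMeasure (μ v)]
    {C : ℝ≥0∞} (h : AffinityBound μ C) {b : ℝ} (hb : 0 ≤ b) {x : α → Fin d → ℝ}
    (hx : Measurable x) (hxb : ∀ a i, |x a i| ≤ b) :
    ENNReal.ofReal (3 / 4 * b) * (d * 2 ^ d) ≤
      (∑ v, ∫⁻ a, ENNReal.ofReal (∑ i, (b + signOf (v i) * x a i)) ∂(μ v)) +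
        ENNReal.ofReal (d * b / 4) * 2 ^ d + ENNReal.ofReal (3 / 4 * b) * C := by
  obtain ⟨ν, L, hν, hL, hL0, hμ, hC⟩ := h
  have hB : ∀ v, ∫⁻ a, ENNReal.ofReal (L v a) ∂ν = 1 := by
    intro v
    rw [← setLIntegral_univ, ← withDensity_apply _ MeasurableSet.univ, ← hμ, measure_univ]
  have hxi : ∀ i, Measurable fun a => x a i := fun i => (measurable_pi_apply i).comp hx
  have hl : ∀ v : Fin d → Bool, Measurable fun a => ∑ i, (b + signOf (v i) * x a i) := fun v =>
    Finset.measurable_fun_sum _ fun i _ => ((hxi i).const_mul _).const_add _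
  have hl0 : ∀ (v : Fin d → Bool) a, 0 ≤ ∑ i, (b + signOf (v i) * x a i) := by
    refine fun v a => Finset.sum_nonneg fun i _ => ?_
    obtain ⟨h1, h2⟩ := abs_le.mp (hxb a i)
    cases v i <;> simp <;> linarith
  have f2 : ∀ i v, Measurable fun a => ENNReal.ofReal √(L v a * L (flipAt i v) a) := fun i v =>
    (((hL v).mul (hL _)).sqrt).ennreal_ofReal
  have f1 : ∀ v, Measurable fun a =>
      ENNReal.ofReal (L v a) * ENNReal.ofReal (∑ i, (b + signOf (v i) * x a i)) := fun v =>
    (hL v).ennreal_ofReal.mul (hl v).ennreal_ofReal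
  have main : ENNReal.ofReal (3 / 4 * b) *
      (∑ i, ∑ v, ∫⁻ a, ENNReal.ofReal √(L v a * L (flipAt i v) a) ∂ν) ≤
      (∑ v, ∫⁻ a, ENNReal.ofReal (∑ i, (b + signOf (v i) * x a i)) ∂(μ v)) +
        ENNReal.ofReal (d * b / 4) * 2 ^ d := by
    have e1 : ∑ v, ∫⁻ a, ENNReal.ofReal (∑ i, (b + signOf (v i) * x a i)) ∂(μ v) =
        ∫⁻ a, ∑ v, ENNReal.ofReal (L v a) *
          ENNReal.ofReal (∑ i, (b + signOf (v i) * x a i)) ∂ν := by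
      rw [lintegral_finsetSum _ fun v _ => f1 v]
      refine Finset.sum_congr rfl fun v _ => ?_
      rw [hμ, lintegral_withDensity_eq_lintegral_mul _ (hL v).ennreal_ofReal
        (hl v).ennreal_ofReal]
      rfl
    have e2 : ENNReal.ofReal (d * b / 4) * 2 ^ d =
        ∫⁻ a, ENNReal.ofReal (d * b / 4) * ∑ v, ENNReal.ofReal (L v a) ∂ν := by
      rw [lintegral_const_mul _ (Finset.measurable_fun_sum _ fun v _ => (hL v).ennreal_ofReal),
        lintegral_finsetSum _ fun v _ => (hL v).ennreal_ofReal]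
      simp [hB]
    have e3 : ENNReal.ofReal (3 / 4 * b) *
        (∑ i, ∑ v, ∫⁻ a, ENNReal.ofReal √(L v a * L (flipAt i v) a) ∂ν) =
        ∫⁻ a, ENNReal.ofReal (3 / 4 * b) *
          ∑ i, ∑ v, ENNReal.ofReal √(L v a * L (flipAt i v) a) ∂ν := by
      rw [lintegral_const_mul _ (Finset.measurable_fun_sum _ fun i _ =>
        Finset.measurable_fun_sum _ fun v _ => f2 i v),
        lintegral_finsetSum _ fun i _ => Finset.measurable_fun_sum _ fun v _ => f2 i v]
      congr 1
      exact Finset.sum_congr rfl fun i _ => (lintegral_finsetSum _ fun v _ => f2 i v).symm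
    rw [e1, e2, e3, ← lintegral_add_left (Finset.measurable_fun_sum _ fun v _ => f1 v)]
    refine lintegral_mono fun a => ?_
    have key := ENNReal.ofReal_le_ofReal
      (sum_sqrt_le_sum_loss (fun v => hL0 v a) (b := b) (x := x a) (hxb a))
    rw [ENNReal.ofReal_add (Finset.sum_nonneg fun v _ => mul_nonneg (hL0 v a) (hl0 v a))
        (mul_nonneg (by positivity) (Finset.sum_nonneg fun v _ => hL0 v a)),
      ENNReal.ofReal_mul (p := 3 / 4 * b) (by positivity),
      ENNReal.ofReal_mul (p := d * b / 4) (by positivity),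
      ENNReal.ofReal_sum_of_nonneg fun v _ => mul_nonneg (hL0 v a) (hl0 v a),
      ENNReal.ofReal_sum_of_nonneg fun v _ => hL0 v a,
      ENNReal.ofReal_sum_of_nonneg fun i _ => Finset.sum_nonneg fun v _ => Real.sqrt_nonneg _]
      at key
    simp_rw [ENNReal.ofReal_sum_of_nonneg fun v _ => Real.sqrt_nonneg _,
      ENNReal.ofReal_mul (hL0 _ a)] at key
    exact key
  calc _ ≤ ENNReal.ofReal (3 / 4 * b) * _ := mul_le_mul_right hC _
    _ ≤ _ := by
      rw [mul_add]
      exact add_le_add_left main _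


end Affinity

section Instances

/-! ### The hard instances -/

variable {d T : ℕ} {X : Set (Vec d)}

/-- The law of the random gradient `β s`, where the signs `s_i` are independent with means
`γ v_i`. -/
noncomputable def signLaw (γ β : ℝ) (v : Fin d → Bool) : Measure (Vec d) :=
  ∑ s, ENNReal.ofReal (signProb γ v s) • Measure.dirac fun i => β * signOf (s i)

lemma isProbabilityMeasure_signLaw {γ : ℝ} (h0 : 0 ≤ γ) (h1 : γ ≤ 1) (β : ℝ)
    (v : Fin d → Bool) : IsProbabilityMeasure (signLaw γ β v) := by
  constructor
  simp only [signLaw, Measure.coe_finsetSum, Finset.sum_apply, Measure.smul_apply, measure_univ,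
    smul_eq_mul, mul_one]
  rw [← ENNReal.ofReal_sum_of_nonneg fun s _ => signProb_nonneg h0 h1 v s, sum_signProb,
    ENNReal.ofReal_one]

lemma lintegral_signLaw (γ β : ℝ) (v : Fin d → Bool) {F : Vec d → ℝ≥0∞} (hF : Measurable F) :
    ∫⁻ g, F g ∂(signLaw γ β v) =
      ∑ s, ENNReal.ofReal (signProb γ v s) * F fun i => β * signOf (s i) := by
  simp [signLaw, lintegral_finsetSum_measure, lintegral_dirac' _ hF]

lemma integral_signLaw {γ : ℝ} (h0 : 0 ≤ γ) (h1 : γ ≤ 1) (β : ℝ) (v : Fin d → Bool) :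
    ∫ g, g ∂(signLaw γ β v) = fun i => β * γ * signOf (v i) := by
  rw [signLaw, integral_finsetSum_measure fun s _ =>
    (integrable_dirac (by simp)).smul_measure ENNReal.ofReal_ne_top]
  simp_rw [integral_smul_measure, integral_dirac,
    ENNReal.toReal_ofReal (signProb_nonneg h0 h1 v _)]
  ext i
  have := sum_signProb_signOf γ v i
  simp only [Finset.sum_apply, Pi.smul_apply, smul_eq_mul]
  rw [mul_assoc, ← this, Finset.mul_sum]
  exact Finset.sum_congr rfl fun s _ => by ring

/-- The linear function with gradient `β γ v`. -/
noncomputable def signLinear (γ β : ℝ) (v : Fin d → Bool) (x : Vec d) : ℝ :=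
  (fun i => β * γ * signOf (v i)) ⬝ᵥ x

/-- The oracle that answers every query by an independent draw from `signLaw`. -/
noncomputable def signOracle (γ β : ℝ) (v : Fin d → Bool) : Kernel (Vec d) (Vec d) :=
  Kernel.const _ (signLaw γ β v)

/-- Writing the exponent as `(q⁻¹).toReal` covers `q = ∞` too, where it is 0. -/
lemma ellNorm_le {q : ℝ≥0∞} (hq : 1 ≤ q) {x : Vec d} {M : ℝ} (hM : 0 ≤ M)
    (hx : ∀ i, |x i| ≤ M) : ellNorm q x ≤ (d : ℝ) ^ (q⁻¹).toReal * M := by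
  rcases eq_or_ne q ∞ with rfl | hq'
  · simp only [ellNorm, PiLp.norm_eq_ciSup]
    simpa using Real.iSup_le hx hM
  · have hq0 : 0 < q.toReal := ENNReal.toReal_pos (zero_lt_one.trans_le hq).ne' hq'
    rw [ellNorm, PiLp.norm_eq_sum hq0, ENNReal.toReal_inv, ← one_div]
    calc (∑ i, ‖x i‖ ^ q.toReal) ^ (1 / q.toReal)
        ≤ (∑ _i : Fin d, M ^ q.toReal) ^ (1 / q.toReal) := by
          refine Real.rpow_le_rpow (Finset.sum_nonneg fun i _ => by positivity) ?_ (by positivity)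
          exact Finset.sum_le_sum fun i _ => Real.rpow_le_rpow (norm_nonneg _) (hx i) hq0.le
      _ = (d : ℝ) ^ (1 / q.toReal) * M := by
          rw [Finset.sum_const, Finset.card_univ, Fintype.card_fin, nsmul_eq_mul,
            Real.mul_rpow (by positivity) (by positivity), ← Real.rpow_mul hM,
            mul_one_div_cancel hq0.ne', Real.rpow_one]

lemma signOracle_mem {γ β B : ℝ} {p : ℝ≥0∞} (h0 : 0 ≤ γ) (h1 : γ ≤ 1) (hβ : 0 ≤ β)
    (hβB : (d : ℝ) ^ ((ENNReal.conjExponent p)⁻¹).toReal * β ≤ B)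
    (hX : Convex ℝ X) (v : Fin d → Bool) :
    (signLinear γ β v, signOracle γ β v) ∈ convexOracles X p B := by
  have := isProbabilityMeasure_signLaw h0 h1 β v
  refine ⟨⟨hX, fun x _ y _ a b _ _ _ => le_of_eq ?_⟩, ?_, fun x _ => ⟨fun y _ => ?_, ?_⟩⟩
  · simp [signLinear, dotProduct_add, dotProduct_smul]
  · unfold signOracle
    infer_instance
  · simp only [signOracle, Kernel.const_apply, integral_signLaw h0 h1, signLinear, dotProduct_sub]
    linarith
  · simp only [signOracle, Kernel.const_apply, signLaw]
    have hn : ∀ s : Fin d → Bool,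
        ellNorm (ENNReal.conjExponent p) (fun i => β * signOf (s i)) ^ 2 ≤ B ^ 2 := by
      intro s
      refine pow_le_pow_left₀ ?_ ((ellNorm_le le_self_add hβ fun i => ?_).trans hβB) 2
      · have : Fact (1 ≤ ENNReal.conjExponent p) := ⟨le_self_add⟩
        exact norm_nonneg (WithLp.toLp (ENNReal.conjExponent p) fun i => β * signOf (s i))
      · rw [abs_mul, abs_signOf, mul_one, abs_of_nonneg hβ]
    have : ∀ S : Finset (Fin d → Bool), ∀ᵐ g ∂(∑ s ∈ S, ENNReal.ofReal (signProb γ v s) •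
        Measure.dirac fun i => β * signOf (s i)),
        ellNorm (ENNReal.conjExponent p) g ^ 2 ≤ B ^ 2 := by
      intro S
      induction S using Finset.induction_on with
      | empty => simp
      | insert s S hs ih =>
        rw [Finset.sum_insert hs, ae_add_measure_iff]
        refine ⟨Measure.ae_smul_measure ?_ _, ih⟩
        rw [ae_dirac_eq]
        exact hn s
    exact this Finset.univ

/-! ### Laws of transcripts -/

lemma measurable_snoc (t : ℕ) :
    Measurable fun y : (Fin t → Vec d) × Vec d => (Fin.snoc y.1 y.2 : Fin (t + 1) → Vec d) := by
  refine measurable_pi_iff.mpr fun i => ?_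
  refine Fin.lastCases ?_ (fun j => ?_) i
  · simpa using measurable_snd
  · simp only [Fin.snoc_castSucc]
    exact (measurable_pi_apply j).comp measurable_fst

variable {𝒲 : Set (Kernel (Vec d) (Vec d))}

lemma isMarkovKernel_stepKernel (O : Kernel (Vec d) (Vec d)) [IsMarkovKernel O]
    (π : Algorithm X T) (S : Strategy 𝒲) (t : ℕ) : IsMarkovKernel (stepKernel O π S t) := by
  have := S.isMarkov t
  unfold stepKernel
  infer_instance

lemma isMarkovKernel_transcript (O : Kernel (Vec d) (Vec d)) [IsMarkovKernel O]
    (π : Algorithm X T) (S : Strategy 𝒲) (t : ℕ) : IsMarkovKernel (transcript O π S t) := by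
  induction t with
  | zero =>
    unfold transcript
    infer_instance
  | succ t ih =>
    have := isMarkovKernel_stepKernel O π S t
    unfold transcript
    exact Kernel.IsMarkovKernel.map _ (measurable_snoc t)

/-- The oracle ignores the query point, so the channel output is a mixture of the `2^d` channel rows
at the points `βs`, the form needed in `AffinityBound.compProd`. -/
lemma stepKernel_signOracle {γ : ℝ} (h0 : 0 ≤ γ) (h1 : γ ≤ 1) (β : ℝ) (v : Fin d → Bool)
    (π : Algorithm X T) (S : Strategy 𝒲) (t : ℕ) (h : History d t) :
    stepKernel (signOracle γ β v) π S t h =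
      ∑ s, ENNReal.ofReal (signProb γ v s) • S.channel t (h, fun i => β * signOf (s i)) := by
  have := isProbabilityMeasure_signLaw h0 h1 β v
  have : IsMarkovKernel (signOracle γ β v) := by unfold signOracle; infer_instance
  ext A hA
  have hm := (S.channel t).measurable_coe hA
  rw [stepKernel, Kernel.comp_apply' _ _ _ hA, Kernel.prod_apply, Kernel.id_apply,
    Kernel.comap_apply, signOracle, Kernel.const_apply, Measure.dirac_prod,
    lintegral_map hm measurable_prodMk_left,
    lintegral_signLaw γ β v (F := fun a => S.channel t (h, a) A) (hm.comp measurable_prodMk_left)]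
  simp

lemma affinityBound_transcript {γ ε : ℝ} (h0 : 0 ≤ γ) (h1 : γ < 1) (hε : 0 ≤ ε) (β : ℝ)
    (π : Algorithm X T) (S : Strategy (ldpChannels (d := d) ε)) (u : ℝ) (t : ℕ) :
    AffinityBound (fun v => transcript (signOracle γ β v) π S t u)
      (t * (ENNReal.ofReal (2 * γ ^ 2 / (1 - γ ^ 2) * (Real.exp ε - 1) ^ 2) * 2 ^ d)) := by
  have hO : ∀ v : Fin d → Bool, IsMarkovKernel (signOracle γ β v) := by
    intro v
    have := isProbabilityMeasure_signLaw h0 h1.le β v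
    unfold signOracle
    infer_instance
  induction t with
  | zero =>
    simp only [transcript, Kernel.const_apply, Nat.cast_zero, zero_mul]
    exact affinityBound_const _
  | succ t ih =>
    have hstep := fun v => isMarkovKernel_stepKernel (signOracle γ β v) π S t
    have htr := fun v => isMarkovKernel_transcript (signOracle γ β v) π S t
    have hch := S.isMarkov t
    have hmeas : ∀ s : Fin d → Bool, Measurable fun y : Fin t → Vec d =>
        (((u, y), fun i => β * signOf (s i)) : History d t × Vec d) := fun s =>
      measurable_prodMk_left.prodMk measurable_const
    -- With the seed and the past outputs fixed, the selected channel is private, which gives the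
    -- ratio `E = e^ε`; `Fin.init` and the last entry undo `Fin.snoc`.
    have key := (ih.compProd h0 h1 (Real.one_le_exp hε)
      (fun s => (S.channel t).comap _ (hmeas s))
      (fun s s' y A hA => (S.channel_mem t (u, y)).2 _ _ A hA)
      (fun v => (stepKernel (signOracle γ β v) π S t).sectR u)
      (fun v y => stepKernel_signOracle h0 h1.le β v π S t (u, y))).map
      (measurable_snoc t) (g := fun z => (Fin.init z, z (Fin.last t)))
      ((measurable_pi_iff.mpr fun j => measurable_pi_apply _).prodMk (measurable_pi_apply _))
      (fun a => by simp)
    have e : ∀ v, transcript (signOracle γ β v) π S (t + 1) u =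
        (transcript (signOracle γ β v) π S t u ⊗ₘ
          (stepKernel (signOracle γ β v) π S t).sectR u).map
            fun y => (Fin.snoc y.1 y.2 : Fin (t + 1) → Vec d) := by
      intro v
      rw [transcript, Kernel.map_apply _ (measurable_snoc t),
        Kernel.compProd_apply_eq_compProd_sectR]
    simp_rw [e]
    convert key using 1
    push_cast
    ring


end Instances

section LowerBound

/-! ### The lower bound -/

variable {d T : ℕ}

/-- The cube `[-b, b]^d`. -/
def cube (d : ℕ) (b : ℝ) : Set (Vec d) := {x | ∀ i, |x i| ≤ b}

lemma convex_cube (b : ℝ) : Convex ℝ (cube d b) := by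
  have : cube d b = ⋂ i, (LinearMap.proj i : Vec d →ₗ[ℝ] ℝ) ⁻¹' Set.Icc (-b) b := by
    ext x
    simp [cube, abs_le]
  rw [this]
  exact convex_iInter fun i => (convex_Icc _ _).linear_preimage _

lemma cube_mem_domains {p : ℝ≥0∞} (hp : 1 ≤ p) {b D : ℝ} (hb : 0 ≤ b)
    (hbD : (d : ℝ) ^ (p⁻¹).toReal * (2 * b) ≤ D) : cube d b ∈ domains p D := by
  refine ⟨⟨0, fun i => by simpa using hb⟩, ?_, convex_cube b, fun x hx y hy => ?_⟩
  · simp only [cube, Set.ofPred_forall]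
    exact isClosed_iInter fun i =>
      isClosed_le (continuous_abs.comp (continuous_apply i)) continuous_const
  · refine (ellNorm_le hp (by linarith) fun i => ?_).trans hbD
    have := abs_sub (x i) (y i)
    rw [Pi.sub_apply]
    linarith [hx i, hy i]

/-- The minimizer over the cube is the vertex `-bv`, with value `-βγdb`. -/
lemma signLinear_sub_sInf_ge {γ β b : ℝ} (h0 : 0 ≤ γ) (hβ : 0 ≤ β) (hb : 0 ≤ b)
    (v : Fin d → Bool) (x : Vec d) :
    β * γ * ∑ i, (b + signOf (v i) * x i) ≤
      signLinear γ β v x - sInf (signLinear γ β v '' cube d b) := by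
  have e : ∀ y : Vec d, signLinear γ β v y =
      β * γ * ∑ i, (b + signOf (v i) * y i) - β * γ * (d * b) := by
    intro y
    simp only [signLinear, dotProduct, Finset.mul_sum, Finset.sum_add_distrib, mul_add,
      Finset.sum_const, Finset.card_univ, Fintype.card_fin, nsmul_eq_mul]
    rw [add_sub_cancel_left]
    exact Finset.sum_congr rfl fun i _ => by ring
  have hbdd : BddBelow (signLinear γ β v '' cube d b) := by
    refine ⟨-(β * γ * (d * b)), ?_⟩
    rintro _ ⟨y, hy, rfl⟩
    rw [e]
    have : 0 ≤ ∑ i, (b + signOf (v i) * y i) := by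
      refine Finset.sum_nonneg fun i _ => ?_
      obtain ⟨h1, h2⟩ := abs_le.mp (hy i)
      cases v i <;> simp <;> linarith
    have := mul_nonneg (mul_nonneg hβ h0) this
    linarith
  have hmem : signLinear γ β v (fun i => -(b * signOf (v i))) ∈ signLinear γ β v '' cube d b :=
    ⟨_, fun i => by rw [abs_neg, abs_mul, abs_signOf, mul_one, abs_of_nonneg hb], rfl⟩
  have h := csInf_le hbdd hmem
  have hz : ∑ i, (b + signOf (v i) * -(b * signOf (v i))) = 0 :=
    Finset.sum_eq_zero fun i _ => by linear_combination -b * signOf_mul_self (v i)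
  rw [e, hz] at h
  rw [e x]
  linarith

/-- The lower bound for a family of sign oracles of arbitrary bias `γ` and scale `β`. -/
lemma le_minmaxError_cube {γ β b B ε : ℝ} {p : ℝ≥0∞} (h0 : 0 ≤ γ) (h1 : γ < 1) (hβ : 0 ≤ β)
    (hb : 0 ≤ b) (hε : 0 ≤ ε)
    (hβB : (d : ℝ) ^ ((ENNReal.conjExponent p)⁻¹).toReal * β ≤ B) :
    ENNReal.ofReal (β * γ * (b * (d / 2 -
        3 / 4 * (T * (2 * γ ^ 2 / (1 - γ ^ 2) * (Real.exp ε - 1) ^ 2))))) ≤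
      minmaxError (cube d b) (convexOracles (cube d b) p B) T (ldpChannels ε) := by
  refine le_iInf fun π => le_iInf fun S => ?_
  set c := 2 * γ ^ 2 / (1 - γ ^ 2) * (Real.exp ε - 1) ^ 2 with hcdef
  have hc : 0 ≤ c := mul_nonneg (div_nonneg (by positivity) (by nlinarith)) (sq_nonneg _)
  set s := ⨆ fO ∈ convexOracles (cube d b) p B, optError fO.1 fO.2 π S
  have hprob := π.isProb
  have hmark : ∀ v : Fin d → Bool, IsMarkovKernel (transcript (signOracle γ β v) π S T) := by
    intro v
    have := isProbabilityMeasure_signLaw h0 h1.le β v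
    have : IsMarkovKernel (signOracle γ β v) := by unfold signOracle; infer_instance
    exact isMarkovKernel_transcript _ π S T
  have hout : ∀ i, Measurable fun h : History d T => π.output h i := fun i =>
    (measurable_pi_apply i).comp π.output_measurable
  have hloss : ∀ v : Fin d → Bool, Measurable fun h : History d T =>
      ENNReal.ofReal (∑ i, (b + signOf (v i) * π.output h i)) := fun v =>
    (Finset.measurable_fun_sum _ fun i _ => ((hout i).const_mul _).const_add _).ennreal_ofReal
  have hopt : ∀ v : Fin d → Bool,
      ENNReal.ofReal (β * γ) * ∫⁻ u, ∫⁻ y, ENNReal.ofReal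
        (∑ i, (b + signOf (v i) * π.output (u, y) i))
          ∂(transcript (signOracle γ β v) π S T u) ∂π.seed ≤ s := by
    intro v
    refine le_trans ?_ (le_iSup₂ (f := fun fO (_ : fO ∈ convexOracles (cube d b) p B) =>
      optError fO.1 fO.2 π S) _ (signOracle_mem h0 h1.le hβ hβB (convex_cube b) v))
    rw [← lintegral_const_mul _ (hloss v).lintegral_kernel_prod_right']
    refine lintegral_mono fun u => ?_
    rw [← lintegral_const_mul' _ _ ENNReal.ofReal_ne_top]
    refine lintegral_mono fun y => ?_
    rw [← ENNReal.ofReal_mul (mul_nonneg hβ h0)]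
    exact ENNReal.ofReal_le_ofReal (signLinear_sub_sInf_ge h0 hβ hb v _)
  -- The coefficient `1/2` of `d` is `3/4 - 1/4` from the testing bound. The estimate holds for each
  -- seed, so randomization does not help.
  have hu : ∀ u, ENNReal.ofReal (b * (d / 2 - 3 / 4 * (T * c))) * 2 ^ d ≤
      ∑ v : Fin d → Bool, ∫⁻ y, ENNReal.ofReal (∑ i, (b + signOf (v i) * π.output (u, y) i))
        ∂(transcript (signOracle γ β v) π S T u) := by
    intro u
    have key := (affinityBound_transcript h0 h1 hε β π S u T).le_sum_loss hb
      (x := fun y => π.output (u, y)) (π.output_measurable.comp measurable_prodMk_left)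
      (fun y => π.output_mem (u, y))
    have e2 : (2 : ℝ≥0∞) ^ d = ENNReal.ofReal (2 ^ d) := by
      rw [ENNReal.ofReal_pow zero_le_two]
      simp
    rw [← hcdef, e2, add_assoc, ← ENNReal.ofReal_natCast d, ← ENNReal.ofReal_natCast T,
      ← ENNReal.ofReal_mul (by positivity), ← ENNReal.ofReal_mul (by positivity),
      ← ENNReal.ofReal_mul (by positivity), ← ENNReal.ofReal_mul (by positivity),
      ← ENNReal.ofReal_mul (by positivity), ← ENNReal.ofReal_mul (by positivity),
      ← ENNReal.ofReal_add (by positivity) (by positivity), ← tsub_le_iff_right,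
      ← ENNReal.ofReal_sub _ (by positivity)] at key
    rw [e2, ← ENNReal.ofReal_mul' (by positivity)]
    refine le_trans (le_of_eq ?_) key
    congr 1
    ring
  -- The worst case over `v` dominates the average over the `2^d` instances.
  have hN : ENNReal.ofReal (β * γ * (b * (d / 2 - 3 / 4 * (T * c)))) * 2 ^ d ≤ s * 2 ^ d := by
    calc _ = ENNReal.ofReal (β * γ) *
          ∫⁻ _, ENNReal.ofReal (b * (d / 2 - 3 / 4 * (T * c))) * 2 ^ d ∂π.seed := by
          rw [lintegral_const, measure_univ, mul_one,
            ENNReal.ofReal_mul (mul_nonneg hβ h0), mul_assoc]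
      _ ≤ ENNReal.ofReal (β * γ) * ∫⁻ u, ∑ v : Fin d → Bool, ∫⁻ y, ENNReal.ofReal
            (∑ i, (b + signOf (v i) * π.output (u, y) i))
              ∂(transcript (signOracle γ β v) π S T u) ∂π.seed :=
          mul_le_mul_right (lintegral_mono hu) _
      _ = ∑ v : Fin d → Bool, ENNReal.ofReal (β * γ) * ∫⁻ u, ∫⁻ y, ENNReal.ofReal
            (∑ i, (b + signOf (v i) * π.output (u, y) i))
              ∂(transcript (signOracle γ β v) π S T u) ∂π.seed := by
          rw [lintegral_finsetSum _ fun v _ => (hloss v).lintegral_kernel_prod_right',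
            Finset.mul_sum]
      _ ≤ ∑ _v : Fin d → Bool, s := Finset.sum_le_sum fun v _ => hopt v
      _ = s * 2 ^ d := by simp [mul_comm]
  exact (ENNReal.mul_le_mul_iff_left (by simp) (by simp)).mp hN

/-- The sup norm is the smallest of the `ℓ_q` norms. A lower bound for the class of `p` thus implies
the one for the class of `1`. -/
lemma convexOracles_subset_one {X : Set (Vec d)} (p : ℝ≥0∞) (B : ℝ) :
    convexOracles X p B ⊆ convexOracles X 1 B := by
  rintro fO ⟨h1, h2, h3⟩
  refine ⟨h1, h2, fun x hx => ⟨(h3 x hx).1, (h3 x hx).2.mono fun g hg => ?_⟩⟩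
  have : Fact (1 ≤ ENNReal.conjExponent p) := ⟨le_self_add⟩
  have hle : ellNorm (ENNReal.conjExponent 1) g ≤ ellNorm (ENNReal.conjExponent p) g := by
    have e : ENNReal.conjExponent 1 = ∞ := by simp [ENNReal.conjExponent]
    rw [e, ellNorm, PiLp.norm_eq_ciSup]
    exact Real.iSup_le (fun i => PiLp.norm_apply_le (WithLp.toLp (ENNReal.conjExponent p) g) i) (norm_nonneg _)
  have h0 : 0 ≤ ellNorm (ENNReal.conjExponent 1) g := by
    have : Fact (1 ≤ ENNReal.conjExponent 1) := ⟨le_self_add⟩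
    exact norm_nonneg (WithLp.toLp (ENNReal.conjExponent 1) g)
  exact (pow_le_pow_left₀ h0 hle 2).trans hg

/-- On `[0, 1]` the convex function `exp` lies below its chord. -/
lemma exp_sub_one_le {ε : ℝ} (h0 : 0 ≤ ε) (h1 : ε ≤ 1) :
    Real.exp ε - 1 ≤ (Real.exp 1 - 1) * ε := by
  have := convexOn_exp.2 (Set.mem_univ 0) (Set.mem_univ 1) (sub_nonneg.mpr h1) h0 (by ring)
  simp only [smul_eq_mul, mul_zero, mul_one, zero_add, Real.exp_zero] at this
  linarith

end LowerBound

end PrivOpt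

/-! ### Calibration of the bias and the scales -/

theorem theoremt (d : ℕ) (hd : 1 ≤ d) (p : ℝ≥0∞) (hp1 : 1 ≤ p) (hp2 : p < 2)
    (ε D B : ℝ) (hε : ε ∈ Set.Icc (0 : ℝ) 1) (hD : 0 < D) (hB : 0 < B) (T : ℕ)
    (hT : 1 / (2 * Real.exp 1 * (Real.exp 1 - 1) ^ 2) * (d : ℝ) ≤ (T : ℝ) * ε ^ 2) :
    (ENNReal.ofReal (1 / (36 * (Real.exp 1 - 1) * √(2 * Real.exp 1)) * D * B / √(T : ℝ)
        * √((d : ℝ) / ε ^ 2))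
      ≤ ⨆ X ∈ (PrivOpt.domains p D : Set (Set (PrivOpt.Vec d))),
          PrivOpt.minmaxError X (PrivOpt.convexOracles X 1 B) T (PrivOpt.ldpChannels ε)) ∧
    (ENNReal.ofReal (1 / (36 * (Real.exp 1 - 1) * √(2 * Real.exp 1)) * D * B / √(T : ℝ)
        * √((d : ℝ) / ε ^ 2))
      ≤ ⨆ X ∈ (PrivOpt.domains p D : Set (Set (PrivOpt.Vec d))),
          PrivOpt.minmaxError X (PrivOpt.convexOracles X p B) T (PrivOpt.ldpChannels ε)) := by
  suffices h : ∃ X ∈ (PrivOpt.domains p D : Set (Set (PrivOpt.Vec d))),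
      ENNReal.ofReal (1 / (36 * (Real.exp 1 - 1) * √(2 * Real.exp 1)) * D * B / √(T : ℝ)
        * √((d : ℝ) / ε ^ 2)) ≤
      PrivOpt.minmaxError X (PrivOpt.convexOracles X p B) T (PrivOpt.ldpChannels ε) by
    obtain ⟨X, hX, hle⟩ := h
    refine ⟨(hle.trans ?_).trans (le_iSup₂ (f := fun X (_ : X ∈ PrivOpt.domains p D) =>
      PrivOpt.minmaxError X (PrivOpt.convexOracles X 1 B) T (PrivOpt.ldpChannels ε)) X hX),
      hle.trans (le_iSup₂ (f := fun X (_ : X ∈ PrivOpt.domains p D) =>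
      PrivOpt.minmaxError X (PrivOpt.convexOracles X p B) T (PrivOpt.ldpChannels ε)) X hX)⟩
    exact iInf_mono fun π => iInf_mono fun S =>
      biSup_mono fun fO hfO => PrivOpt.convexOracles_subset_one p B hfO
  obtain ⟨hε0, hε1⟩ := hε
  have hd0 : (0 : ℝ) < d := by exact_mod_cast hd
  have he2 : 2 ≤ Real.exp 1 := by linarith [Real.add_one_le_exp 1]
  -- `A^2 = 1/c₀`, so the condition on `T` says that `√(d / (T ε^2)) ≤ A`.
  set A := (Real.exp 1 - 1) * √(2 * Real.exp 1) with hA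
  have hA0 : 0 < A := mul_pos (by linarith) (Real.sqrt_pos.mpr (by linarith))
  have hA2 : A ^ 2 = 2 * Real.exp 1 * (Real.exp 1 - 1) ^ 2 := by
    rw [hA, mul_pow, Real.sq_sqrt (by linarith)]
    ring
  rw [← hA2] at hT
  -- The condition on `T` excludes `T = 0` and `ε = 0`, where division by zero would matter.
  have hn0 : 0 < T * ε ^ 2 := lt_of_lt_of_le (by positivity) hT
  set r := √(d / (T * ε ^ 2)) with hr
  have hr0 : 0 ≤ r := Real.sqrt_nonneg _
  have hr2 : r ^ 2 * (T * ε ^ 2) = d := by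
    rw [hr, Real.sq_sqrt (by positivity), div_mul_cancel₀ _ hn0.ne']
  have hrA : r ≤ A := by
    refine Real.sqrt_le_iff.mpr ⟨hA0.le, ?_⟩
    rw [div_le_iff₀ hn0]
    rw [one_div, inv_mul_le_iff₀ (by positivity)] at hT
    exact hT
  -- This bias is at most `1/2`, and turns the target into `DBγ/18`.
  set γ := r / (2 * A) with hγ
  have hγ0 : 0 ≤ γ := by positivity
  have hγ1 : γ ≤ 1 / 2 := by
    rw [hγ, div_le_iff₀ (by positivity)]
    linarith
  have htarget : 1 / (36 * (Real.exp 1 - 1) * √(2 * Real.exp 1)) * D * B / √(T : ℝ) *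
      √((d : ℝ) / ε ^ 2) = D * B * γ / 18 := by
    have : √((d : ℝ) / ε ^ 2) / √(T : ℝ) = r := by
      rw [hr, ← Real.sqrt_div' _ (Nat.cast_nonneg T), div_div, mul_comm (ε ^ 2)]
    rw [mul_assoc 36, ← hA, div_mul_eq_mul_div, mul_div_assoc, this, hγ]
    field_simp
    ring
  have hholder := ENNReal.HolderConjugate.conjExponent hp1
  set q := ENNReal.conjExponent p with hq
  have hq1 : 1 ≤ q := le_self_add
  have hsum : (p⁻¹).toReal + (q⁻¹).toReal = 1 := by
    rw [← ENNReal.toReal_add (ENNReal.inv_ne_top.mpr (zero_lt_one.trans_le hp1).ne')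
      (ENNReal.inv_ne_top.mpr (zero_lt_one.trans_le hq1).ne'),
      hholder.inv_add_inv_eq_one, ENNReal.toReal_one]
  set P := (d : ℝ) ^ (p⁻¹).toReal with hP
  set Q := (d : ℝ) ^ (q⁻¹).toReal with hQ
  have hP0 : 0 < P := Real.rpow_pos_of_pos hd0 _
  have hQ0 : 0 < Q := Real.rpow_pos_of_pos hd0 _
  have hPQ : P * Q = d := by rw [hP, hQ, ← Real.rpow_add hd0, hsum, Real.rpow_one]
  have hb0 : 0 ≤ D / (2 * P) := by positivity
  have hβ0 : 0 ≤ B / Q := by positivity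
  -- The largest cube of `ℓ_p` diameter `D`, paired with gradients `±B/Q` in each coordinate, of
  -- `ℓ_q` norm `B`. The dimension factors combine through `P * Q = d`.
  refine ⟨PrivOpt.cube d (D / (2 * P)), PrivOpt.cube_mem_domains hp1 hb0 (le_of_eq ?_), ?_⟩
  · rw [← hP]
    field_simp
  refine le_trans ?_ (PrivOpt.le_minmaxError_cube (γ := γ) hγ0 (by linarith) hβ0 hb0 hε0
    (le_of_eq (mul_div_cancel₀ B hQ0.ne')))
  rw [htarget]
  refine ENNReal.ofReal_le_ofReal ?_
  -- The total leak: `γ ≤ 1/2` gives `1/(1 - γ^2) ≤ 4/3`, and the choice of `γ` gives `γ^2 (e - 1)^2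
  -- T ε^2 = d/(8e)`; then `e ≥ 2`.
  have hinfo : T * (2 * γ ^ 2 / (1 - γ ^ 2) * (Real.exp ε - 1) ^ 2) ≤ d / 6 := by
    have a1 : (Real.exp ε - 1) ^ 2 ≤ ((Real.exp 1 - 1) * ε) ^ 2 :=
      pow_le_pow_left₀ (by linarith [Real.one_le_exp hε0]) (PrivOpt.exp_sub_one_le hε0 hε1) 2
    have a2 : 2 * γ ^ 2 / (1 - γ ^ 2) ≤ 8 / 3 * γ ^ 2 := by
      rw [div_le_iff₀ (by nlinarith)]
      nlinarith [sq_nonneg γ, mul_nonneg (sq_nonneg γ) (by nlinarith : 0 ≤ 1 / 4 - γ ^ 2)]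
    have a3 : γ ^ 2 * (Real.exp 1 - 1) ^ 2 * (T * ε ^ 2) = d / (8 * Real.exp 1) := by
      have : Real.exp 1 - 1 ≠ 0 := (sub_pos.mpr (by linarith)).ne'
      rw [hγ, div_pow, mul_pow, hA2, ← hr2]
      field_simp
      ring
    calc T * (2 * γ ^ 2 / (1 - γ ^ 2) * (Real.exp ε - 1) ^ 2)
        ≤ T * (8 / 3 * γ ^ 2 * ((Real.exp 1 - 1) * ε) ^ 2) := by gcongr
      _ = 8 / 3 * (γ ^ 2 * (Real.exp 1 - 1) ^ 2 * (T * ε ^ 2)) := by ring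
      _ = 8 / 3 * (d / (8 * Real.exp 1)) := by rw [a3]
      _ ≤ 8 / 3 * (d / (8 * 2)) := by gcongr
      _ = d / 6 := by ring
  have hfac : B / Q * γ * (D / (2 * P)) * d = D * B * γ / 2 := by
    rw [← hPQ]
    field_simp
  -- Here `3/8 = 1/2 - (3/4)(1/6)`; the argument yields `3/16` where `1/18` is needed.
  calc D * B * γ / 18 ≤ D * B * γ / 2 * (3 / 8) := by
        have : 0 ≤ D * B * γ := by positivity
        linarith
    _ = B / Q * γ * (D / (2 * P) * (d / 2 - 3 / 4 * (d / 6))) := by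
        rw [← hfac]
        ring
    _ ≤ _ := by gcongr
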